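/- Let $n\ge 2$ be an integer and let $p_1,\dots,p_k$ be the distinct primes dividing $n$. Let $a,a'$ be squarefree integers with $a\equiv a' \pmod{n\,p_1\cdots p_k}$. Let $K=\mathbb{Q}(\theta)$ and $K'=\mathbb{Q}(\theta')$ be number fields of degree $n$ over $\mathbb{Q}$, where $\theta^n=a$ and $\theta'^n=a'$ (so $x^n-a$ and $x^n-a'$ are irreducible over $\mathbb{Q}$). Then for all integers $c_0,\dots,c_{n-1}$ and every non-zero integer $q$, the element $\frac1q\left(c_0+c_1\theta+\cdots+c_{n-1}\theta^{n-1}\right)$ of $K$ is an algebraic integer if and only if the element $\frac1q\left(c_0+c_1\theta'+\cdots+c_{n-1}\theta'^{\,n-1}\right)$ of $K'$ is an algebraic integer. That is, integral bases are periodic in $a$ with period $n\,p_1\cdots p_k$: for all rational numbers $b_{m,i}$ $(0\le m,i\le n-1)$, the elements $\sum_{i=0}^{n-1} b_{m,i}\theta^i$ $(0\le m\le n-1)$ form an integral basis of $K$ (a $\mathbb{Z}$-basis of its ring of algebraic integers) if and only if the elements $\sum_{i=0}^{n-1} b_{m,i}\theta'^{\,i}$ $(0\le m\le n-1)$ form an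 integral basis of $K'$. -/

import Mathlib

/-- A finite family `ω` in a number field `K` is an integral basis of `K`: it is a `ℤ`-basis of the
ring of algebraic integers of `K`. -/
def IsIntegralBasis (K : Type*) [Field K] {n : ℕ} (ω : Fin n → K) : Prop :=
  LinearIndependent ℤ ω ∧
    ((Submodule.span ℤ (Set.range ω) : Submodule ℤ K) : Set K) = {x : K | IsIntegral ℤ x}

open Polynomial

/-! ### Valuations of integers, roots of unity and sums -/

namespace Valuation

variable {L Γ₀ : Type*} [Field L] [LinearOrderedCommGroupWithZero Γ₀] (v : Valuation L Γ₀)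

/-! Write f = ∑ cᵢXⁱ. Embed everything in an algebraically closed L. By irreducibility of Xⁿ - a,
f(θ)/q is integral iff f(x)/q is for every root x of Xⁿ - a, and integrality in L is tested by
valuations v. So it suffices that a bound v(f(x)) ≤ v(q) at all roots x of a passes to each root x'
of a'.

If v(a) < 1, then a is squarefree at the prime below v, an Eisenstein situation: the terms cᵢxⁱ have
distinct values, so every v(cᵢ) ≤ v(q). If v(a) = 1, Lagrange interpolation gives f(T) = ∑ₓ f(x)/(n
xⁿ⁻¹) ∏_{y≠x}(T - y). When v(n) = 1, this again bounds the coefficients. When v(n) < 1, put T = x':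
the congruence gives v(∏_{y≠x}(x' - y)) ≤ v(n), which cancels the denominator
(`map_prod_erase_sub_le`). -/

theorem map_intCast_le_one (m : ℤ) : v (m : L) ≤ 1 :=
  intCast_mem v.integer m

theorem map_intCast_eq_one_of_isCoprime {p u : ℤ} (h : IsCoprime p u) (hp : v (p : L) < 1) :
    v (u : L) = 1 := by
  obtain ⟨x, y, hxy⟩ := h
  refine le_antisymm (v.map_intCast_le_one u) (not_lt.mp fun hu => ?_)
  have h1 : ((x : L) * p + y * u) = 1 := by exact_mod_cast congrArg (Int.cast : ℤ → L) hxy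
  have h2 : v ((x : L) * p + y * u) < 1 := by
    refine v.map_add_lt ?_ ?_ <;> rw [map_mul]
    · exact mul_lt_one_of_nonneg_of_lt_one_right (v.map_intCast_le_one x) zero_le hp
    · exact mul_lt_one_of_nonneg_of_lt_one_right (v.map_intCast_le_one y) zero_le hu
  rw [h1, map_one] at h2
  exact lt_irrefl _ h2

theorem exists_prime_dvd_map_lt_one {m : ℕ} (hm : m ≠ 0) (h : v (m : L) < 1) :
    ∃ p : ℕ, p.Prime ∧ p ∣ m ∧ v (p : L) < 1 := by
  induction m using Nat.recOnMul with
  | zero => exact absurd rfl hm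
  | one => simp at h
  | prime p hp => exact ⟨p, hp, dvd_rfl, h⟩
  | mul a b iha ihb =>
    have ha : a ≠ 0 := left_ne_zero_of_mul hm
    have hb : b ≠ 0 := right_ne_zero_of_mul hm
    by_cases h1 : v (a : L) < 1
    · obtain ⟨p, hp, hd, hv⟩ := iha ha h1
      exact ⟨p, hp, hd.mul_right b, hv⟩
    by_cases h2 : v (b : L) < 1
    · obtain ⟨p, hp, hd, hv⟩ := ihb hb h2
      exact ⟨p, hp, hd.mul_left a, hv⟩
    · rw [Nat.cast_mul, map_mul] at h
      exact absurd h (not_lt.mpr (one_le_mul (not_lt.mp h1) (not_lt.mp h2)))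

theorem map_eq_one_of_pow_eq_one {n : ℕ} (hn : n ≠ 0) {x : L} (h : v (x ^ n) = 1) : v x = 1 := by
  rw [map_pow] at h
  exact (pow_eq_one_iff_of_nonneg zero_le hn).mp h

/-- Some power ξ of ζ has prime order ℓ. As 1 + ξ + ⋯ + ξ^(ℓ-1) = 0, ℓ is minus the sum of the ξⁱ -
1, all multiples of ξ - 1 and hence of ζ - 1. If ℓ ≠ p, then ℓ has value 1. -/
theorem map_prime_le_map_sub_one {n p : ℕ} (hn : n ≠ 0) (hp : p.Prime) (hvp : v (p : L) < 1)
    {ζ : L} (hζ : ζ ^ n = 1) (hζ1 : ζ ≠ 1) : v (p : L) ≤ v (ζ - 1) := by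
  have hd0 : orderOf ζ ≠ 0 := fun h0 =>
    hn (Nat.eq_zero_of_zero_dvd (h0 ▸ orderOf_dvd_of_pow_eq_one hζ))
  have hd1 : orderOf ζ ≠ 1 := fun h1 => hζ1 (orderOf_eq_one_iff.mp h1)
  have hℓ : (orderOf ζ).minFac.Prime := Nat.minFac_prime hd1
  set ℓ := (orderOf ζ).minFac
  obtain ⟨k, hk⟩ : ℓ ∣ orderOf ζ := Nat.minFac_dvd _
  have hξℓ : (ζ ^ k) ^ ℓ = 1 := by rw [← pow_mul, mul_comm, ← hk, pow_orderOf_eq_one]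
  have hk0 : k ≠ 0 := by rintro rfl; exact hd0 (by simpa using hk)
  have hξ1 : ζ ^ k ≠ 1 := fun h => by
    have := Nat.le_of_dvd (Nat.pos_of_ne_zero hk0) (orderOf_dvd_of_pow_eq_one h)
    rw [hk] at this
    have := hℓ.two_le
    nlinarith [Nat.pos_of_ne_zero hk0]
  have hvζ : v ζ = 1 := v.map_eq_one_of_pow_eq_one hn (by rw [hζ, map_one])
  have key (x : L) (hx : v x ≤ 1) (m : ℕ) : v (x ^ m - 1) ≤ v (x - 1) := by
    rw [← geom_sum_mul, map_mul]
    refine mul_le_of_le_one_left' (v.map_sum_le fun i _ => ?_)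
    rw [map_pow]
    exact pow_le_one' hx i
  have hsum : ∑ i ∈ Finset.range ℓ, (ζ ^ k) ^ i = 0 := by
    have := geom_sum_mul (ζ ^ k) ℓ
    rw [hξℓ, sub_self] at this
    exact (mul_eq_zero.mp this).resolve_right (sub_ne_zero.mpr hξ1)
  have hle : v (ℓ : L) ≤ v (ζ ^ k - 1) := by
    have : (ℓ : L) = - ∑ i ∈ Finset.range ℓ, ((ζ ^ k) ^ i - 1) := by
      rw [Finset.sum_sub_distrib, hsum]; simp
    rw [this, map_neg]
    exact v.map_sum_le fun i _ => key _ (by rw [map_pow, hvζ, one_pow]) i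
  refine le_trans ?_ (hle.trans (key ζ hvζ.le k))
  by_cases hpl : p = ℓ
  · rw [← hpl]
  · have := v.map_intCast_eq_one_of_isCoprime (p := p) (u := ℓ)
      (Nat.isCoprime_iff_coprime.mpr ((Nat.coprime_primes hp hℓ).mpr hpl)) (by simpa using hvp)
    rw [Int.cast_natCast] at this
    exact this ▸ hvp.le

theorem map_coeff_nodal_le_one {s : Finset L} (hs : ∀ x ∈ s, v x ≤ 1) (k : ℕ) :
    v ((Lagrange.nodal s id).coeff k) ≤ 1 := by
  classical
  induction s using Finset.induction_on generalizing k with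
  | empty =>
    rw [Lagrange.nodal_empty, coeff_one]
    split_ifs <;> simp
  | insert x s hx ih =>
    rw [Lagrange.nodal_insert_eq_nodal hx, sub_mul, coeff_sub, coeff_C_mul]
    have ih' := ih fun y hy => hs y (Finset.mem_insert_of_mem hy)
    refine v.map_sub_le ?_ ?_
    · cases k with
      | zero => simp
      | succ k => rw [coeff_X_mul]; exact ih' k
    · rw [map_mul]
      exact mul_le_one' (hs x (Finset.mem_insert_self x s)) (ih' k)

/-- In a sum of terms whose nonzero values are pairwise distinct, each term is bounded by the
sum. -/
theorem map_le_map_sum_of_injOn {ι : Type*} {s : Finset ι} {f : ι → L}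
    (h : ∀ i ∈ s, ∀ j ∈ s, f i ≠ 0 → v (f i) = v (f j) → i = j) {i : ι} (hi : i ∈ s) :
    v (f i) ≤ v (∑ j ∈ s, f j) := by
  classical
  obtain ⟨j, hj, hmax⟩ := s.exists_max_image (fun i => v (f i)) ⟨i, hi⟩
  by_cases h0 : f j = 0
  · have := hmax i hi
    rw [h0, map_zero] at this
    exact this.trans zero_le
  · rw [v.map_sum_eq_of_lt hj fun k hk => ?_]
    · exact hmax i hi
    · rw [Finset.mem_sdiff, Finset.mem_singleton] at hk
      exact lt_of_le_of_ne (hmax k hk.1) fun e => hk.2 (h j hj k hk.1 h0 e.symm).symm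

end Valuation

/-! ### Integrality tested by valuations -/

theorem isIntegral_of_forall_valuationSubring {L : Type*} [Field L] {x : L}
    (h : ∀ V : ValuationSubring L, V.valuation x ≤ 1) : IsIntegral ℤ x := by
  by_contra hx
  have hcl : IsIntegrallyClosedIn (integralClosure ℤ L).toSubring L :=
    inferInstanceAs (IsIntegrallyClosedIn (integralClosure ℤ L) L)
  obtain ⟨V, -, hV⟩ := Subring.exists_le_valuationSubring_of_isIntegrallyClosedIn
    (x := x) (R := (integralClosure ℤ L).toSubring) hx
  exact hV ((V.valuation_le_one_iff x).mp (h V))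

theorem IsIntegral.valuation_le_one {L Γ₀ : Type*} [Field L] [LinearOrderedCommGroupWithZero Γ₀]
    (v : Valuation L Γ₀) {x : L} (h : IsIntegral ℤ x) : v x ≤ 1 := by
  have := Valuation.Integers.mem_of_integral (Valuation.integer.integers v)
    (x := x) (h.tower_top)
  exact this

namespace Valuation

variable {L Γ₀ : Type*} [Field L] [LinearOrderedCommGroupWithZero Γ₀] (v : Valuation L Γ₀)

/-! ### Interpolation at the n-th roots of A -/

section NthRoots

variable {n : ℕ} {A : L} {s : Finset L}

theorem _root_.Lagrange.mem_iff_pow_eq_of_nodal_eq (hs : Lagrange.nodal s id = X ^ n - C A) {x : L} :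
    x ∈ s ↔ x ^ n = A := by
  have := congrArg (eval x) hs
  rw [Lagrange.eval_nodal] at this
  simp only [id, eval_sub, eval_pow, eval_X, eval_C] at this
  rw [← sub_eq_zero (a := x ^ n), ← this, Finset.prod_eq_zero_iff]
  exact ⟨fun h => ⟨x, h, sub_self x⟩, fun ⟨y, hy, h⟩ => sub_eq_zero.mp h ▸ hy⟩

theorem _root_.Lagrange.prod_erase_sub_of_nodal_eq [DecidableEq L]
    (hs : Lagrange.nodal s id = X ^ n - C A) {x : L} (hx : x ∈ s) :
    ∏ y ∈ s.erase x, (x - y) = n * x ^ (n - 1) := by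
  have := Lagrange.eval_nodal_derivative_eval_node_eq (v := id) hx
  rw [hs, Lagrange.eval_nodal] at this
  simpa [derivative_X_pow] using this.symm

theorem _root_.Lagrange.card_eq_of_nodal_eq (hs : Lagrange.nodal s id = X ^ n - C A) : s.card = n := by
  rw [← Lagrange.natDegree_nodal (v := (id : L → L)) (R := L), hs, natDegree_X_pow_sub_C]

/-- Distinct roots are at distance at least v(p). If x' is closer than that to x, it may be replaced
by x, and the product becomes n xⁿ⁻¹. Otherwise the factor x' - x, of value at least v(p), is
divided out of x'ⁿ - A = A' - A. -/
theorem map_prod_erase_sub_le [DecidableEq L] (hn : n ≠ 0) (hs : Lagrange.nodal s id = X ^ n - C A)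
    (hA : v A = 1) {p : ℕ} (hp : p.Prime) (hp0 : (p : L) ≠ 0) (hvp : v (p : L) < 1) {A' x' x : L}
    (hA' : v (A' - A) ≤ v (n : L) * v (p : L)) (hx' : x' ^ n = A') (hx : x ∈ s) :
    v (∏ y ∈ s.erase x, (x' - y)) ≤ v (n : L) := by
  have hvs : ∀ y ∈ s, v y = 1 := fun y hy =>
    v.map_eq_one_of_pow_eq_one hn (by rw [(Lagrange.mem_iff_pow_eq_of_nodal_eq hs).mp hy, hA])
  have hvp0 : 0 < v (p : L) := by rwa [zero_lt_iff, v.ne_zero_iff]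
  by_cases hlt : v (x' - x) < v (p : L)
  · refine le_of_eq ?_
    calc v (∏ y ∈ s.erase x, (x' - y)) = v (∏ y ∈ s.erase x, (x - y)) := by
          rw [map_prod, map_prod]
          refine Finset.prod_congr rfl fun y hy => ?_
          obtain ⟨hyx, hy⟩ := Finset.mem_erase.mp hy
          have hy0 : y ≠ 0 := by
            rintro rfl
            simpa using hvs _ hy
          have hle : v (p : L) ≤ v (x - y) := by
            have h1 : v (p : L) ≤ v (x / y - 1) := by
              refine v.map_prime_le_map_sub_one hn hp hvp ?_ ?_
              · rw [div_pow, (Lagrange.mem_iff_pow_eq_of_nodal_eq hs).mp hx,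
                  (Lagrange.mem_iff_pow_eq_of_nodal_eq hs).mp hy,
                  div_self]
                rintro rfl
                simp at hA
              · rw [Ne, div_eq_one_iff_eq hy0]
                exact fun h => hyx h.symm
            have h2 : x - y = (x / y - 1) * y := by field_simp
            rwa [h2, map_mul, hvs y hy, mul_one]
          rw [← sub_add_sub_cancel x' x y]
          exact v.map_add_eq_of_lt_right (hlt.trans_le hle)
      _ = v (n : L) := by
          rw [Lagrange.prod_erase_sub_of_nodal_eq hs hx, map_mul, map_pow, hvs x hx, one_pow, mul_one]
  · have h1 : v (∏ y ∈ s.erase x, (x' - y)) * v (x' - x) = v (A' - A) := by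
      rw [← map_mul, Finset.prod_erase_mul _ _ hx, ← hx']
      have := congrArg (eval x') hs
      rw [Lagrange.eval_nodal] at this
      simp only [id, eval_sub, eval_pow, eval_X, eval_C] at this
      rw [this]
    refine le_of_mul_le_mul_right ?_ hvp0
    exact (mul_le_mul_right (not_lt.mp hlt) _).trans (h1.le.trans hA')

theorem _root_.Lagrange.eq_sum_interpolate_of_nodal_eq [DecidableEq L]
    (hs : Lagrange.nodal s id = X ^ n - C A) {f : L[X]}
    (hf : f.degree < n) :
    f = ∑ x ∈ s, C (f.eval x / (n * x ^ (n - 1))) * Lagrange.nodal (s.erase x) id := by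
  have hinj : Set.InjOn (id : L → L) s := Function.injective_id.injOn
  refine (Lagrange.eq_interpolate hinj (by rwa [Lagrange.card_eq_of_nodal_eq hs])).trans ?_
  rw [Lagrange.interpolate_apply]
  refine Finset.sum_congr rfl fun x hx => ?_
  rw [Lagrange.basis_eq_prod_sub_inv_mul_nodal_div hx, ← Lagrange.nodal_erase_eq_nodal_div hx,
    ← mul_assoc, ← C_mul, Lagrange.nodalWeight_eq_eval_nodal_erase_inv, Lagrange.eval_nodal]
  simp only [id]
  rw [Lagrange.prod_erase_sub_of_nodal_eq hs hx, div_eq_mul_inv]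

theorem map_eval_le_of_forall_root [DecidableEq L] [CharZero L] (hn : n ≠ 0)
    (hs : Lagrange.nodal s id = X ^ n - C A)
    (hA : v A = 1) {p : ℕ} (hp : p.Prime) (hvp : v (p : L) < 1) {A' x' : L}
    (hA' : v (A' - A) ≤ v (n : L) * v (p : L)) (hx' : x' ^ n = A') {f : L[X]}
    (hf : f.degree < n) {g : Γ₀} (hfs : ∀ x ∈ s, v (f.eval x) ≤ g) : v (f.eval x') ≤ g := by
  have hvn : v (n : L) ≠ 0 := v.ne_zero_iff.mpr (Nat.cast_ne_zero.mpr hn)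
  rw [Lagrange.eq_sum_interpolate_of_nodal_eq hs hf, eval_finsetSum]
  refine v.map_sum_le fun x hx => ?_
  have hvx : v x = 1 := v.map_eq_one_of_pow_eq_one hn
    (by rw [(Lagrange.mem_iff_pow_eq_of_nodal_eq hs).mp hx, hA])
  rw [eval_mul, eval_C, Lagrange.eval_nodal, map_mul, map_div₀, map_mul, map_pow, hvx, one_pow,
    mul_one, div_mul_eq_mul_div]
  refine div_le_of_le_mul₀ zero_le zero_le ?_
  exact mul_le_mul' (hfs x hx)
    (v.map_prod_erase_sub_le hn hs hA hp (Nat.cast_ne_zero.mpr hp.ne_zero) hvp hA' hx' hx)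

theorem map_coeff_le_of_forall_root (hn : n ≠ 0) (hs : Lagrange.nodal s id = X ^ n - C A)
    (hA : v A = 1) (hvn : v (n : L) = 1) {f : L[X]}
    (hf : f.degree < n) {g : Γ₀} (hfs : ∀ x ∈ s, v (f.eval x) ≤ g) (i : ℕ) : v (f.coeff i) ≤ g := by
  classical
  have hvs : ∀ y ∈ s, v y = 1 := fun y hy =>
    v.map_eq_one_of_pow_eq_one hn (by rw [(Lagrange.mem_iff_pow_eq_of_nodal_eq hs).mp hy, hA])
  rw [Lagrange.eq_sum_interpolate_of_nodal_eq hs hf, finsetSum_coeff]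
  refine v.map_sum_le fun x hx => ?_
  rw [coeff_C_mul, map_mul, map_div₀, map_mul, map_pow, hvs x hx, hvn, one_pow, mul_one, div_one]
  exact (mul_le_of_le_one_right' (v.map_coeff_nodal_le_one
    (fun y hy => (hvs y (Finset.mem_of_mem_erase hy)).le) i)).trans (hfs x hx)

end NthRoots

/-! ### The Eisenstein case -/

theorem exists_map_intCast_eq_pow {p : ℕ} (hp : p.Prime) (hvp : v (p : L) < 1) {c : ℤ}
    (hc : c ≠ 0) : ∃ k : ℕ, v (c : L) = v (p : L) ^ k := by
  have hfin : FiniteMultiplicity (p : ℤ) c :=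
    Int.finiteMultiplicity_iff.mpr ⟨by simpa using hp.ne_one, hc⟩
  obtain ⟨u, hcu, hu⟩ := hfin.exists_eq_pow_mul_and_not_dvd
  refine ⟨multiplicity (p : ℤ) c, ?_⟩
  have := v.map_intCast_eq_one_of_isCoprime (p := p) (u := u)
    ((Nat.prime_iff_prime_int.mp hp).irreducible.coprime_iff_not_dvd.mpr hu) (by simpa using hvp)
  conv_lhs => rw [hcu, Int.cast_mul, map_mul, this, mul_one, Int.cast_pow, map_pow,
    Int.cast_natCast]

/-- If the prime below `v` divides the squarefree integer `a`, then an integer bounding a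
linear combination of the powers `x ^ i`, `i < n`, of an `n`-th root of `a` bounds its integer
coefficients. -/
theorem map_intCast_le_of_eisenstein [CharZero L] {n : ℕ} {a : ℤ} (ha : Squarefree a)
    (hva : v (a : L) < 1) {x : L} (hx : x ^ n = a) {c : Fin n → ℤ} {q : ℤ} (hq : q ≠ 0)
    (h : v (∑ i, (c i : L) * x ^ (i : ℕ)) ≤ v (q : L)) (i : Fin n) :
    v (c i : L) ≤ v (q : L) := by
  obtain ⟨p, hp, hpa, hvp⟩ := v.exists_prime_dvd_map_lt_one (m := a.natAbs)
    (Int.natAbs_ne_zero.mpr ha.ne_zero) (by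
      rcases Int.natAbs_eq a with e | e <;> rw [e] at hva <;> simpa using hva)
  have hn : n ≠ 0 := i.pos.ne'
  have hvx : v x ^ n = v (p : L) := by
    rw [← map_pow, hx]
    obtain ⟨b, rfl⟩ := Int.natCast_dvd.mpr hpa
    have hpb : ¬ (p : ℤ) ∣ b := fun hd =>
      (Nat.prime_iff_prime_int.mp hp).not_isUnit (ha _ (mul_dvd_mul_left _ hd))
    have := v.map_intCast_eq_one_of_isCoprime (p := p) (u := b)
      ((Nat.prime_iff_prime_int.mp hp).irreducible.coprime_iff_not_dvd.mpr hpb) (by simpa using hvp)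
    rw [Int.cast_mul, map_mul, this, mul_one, Int.cast_natCast]
  have hp0 : v (p : L) ≠ 0 := v.ne_zero_iff.mpr (Nat.cast_ne_zero.mpr hp.ne_zero)
  have hx0 : 0 < v x := by
    rw [zero_lt_iff]
    intro h0
    rw [h0, zero_pow hn] at hvx
    exact hp0 hvx.symm
  have hx1 : v x < 1 := by
    by_contra hx1
    exact absurd (hvx ▸ hvp) (not_lt.mpr (one_le_pow_of_one_le' (not_lt.mp hx1) n))
  have hanti : StrictAnti fun m : ℕ => v x ^ m := pow_right_strictAnti₀ hx0 hx1
  -- The exponent n * k + j determines j modulo n, so nonzero terms have distinct values.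
  have hterm {k : ℕ} {j : Fin n} (hk : v (c j : L) = v (p : L) ^ k) :
      v ((c j : L) * x ^ (j : ℕ)) = v x ^ (n * k + j) := by
    rw [map_mul, hk, ← hvx, map_pow, pow_add, pow_mul]
  by_cases hc : c i = 0
  · simp [hc]
  obtain ⟨k, hk⟩ := v.exists_map_intCast_eq_pow hp hvp hc
  obtain ⟨l, hl⟩ := v.exists_map_intCast_eq_pow hp hvp hq
  have hle : v ((c i : L) * x ^ (i : ℕ)) ≤ v (q : L) := by
    refine le_trans (v.map_le_map_sum_of_injOn (f := fun i => (c i : L) * x ^ (i : ℕ)) ?_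
      (Finset.mem_univ i)) h
    intro j _ j' _ hj0 hjj'
    have hx0' : x ≠ 0 := v.ne_zero_iff.mp hx0.ne'
    have hcj : c j ≠ 0 := fun e => hj0 (by simp [e])
    have hcj' : c j' ≠ 0 := fun e => by
      simp only [e, Int.cast_zero, zero_mul, map_zero] at hjj'
      exact hj0 (v.zero_iff.mp hjj')
    obtain ⟨k, hk⟩ := v.exists_map_intCast_eq_pow hp hvp hcj
    obtain ⟨k', hk'⟩ := v.exists_map_intCast_eq_pow hp hvp hcj'
    rw [hterm hk, hterm hk'] at hjj'
    have := hanti.injective hjj'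
    have h2 := congrArg (· % n) this
    simpa [Nat.mul_add_mod, Nat.mod_eq_of_lt j.isLt, Nat.mod_eq_of_lt j'.isLt,
      Fin.val_inj] using h2
  rw [hterm hk, hl, ← hvx, ← pow_mul, hanti.le_iff_ge] at hle
  rw [hk, hl]
  -- From n * l ≤ n * k + i and i < n follows l ≤ k.
  refine pow_le_pow_right_of_le_one' hvp.le (not_lt.mp fun hkl => ?_)
  have : n * (k + 1) ≤ n * l := Nat.mul_le_mul_left n hkl
  rw [mul_add] at this
  omega

end Valuation

theorem Lagrange.exists_nodal_eq_X_pow_sub_C {L : Type*} [Field L] [IsAlgClosed L] [CharZero L]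
    {n : ℕ} (hn : n ≠ 0) {A : L} (hA : A ≠ 0) :
    ∃ s : Finset L, Lagrange.nodal s id = X ^ n - C A := by
  have hnodup : (X ^ n - C A).roots.Nodup :=
    nodup_roots (separable_X_pow_sub_C A (Nat.cast_ne_zero.mpr hn) hA)
  refine ⟨⟨_, hnodup⟩, ?_⟩
  exact ((IsAlgClosed.splits _).eq_prod_roots_of_monic (monic_X_pow_sub_C A hn)).symm

/-! ### Passing the bound from roots of a to roots of a' -/

namespace Valuation

variable {L Γ₀ : Type*} [Field L] [LinearOrderedCommGroupWithZero Γ₀] (v : Valuation L Γ₀)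

theorem map_sum_le_of_forall_root [CharZero L] {n : ℕ} (hn : n ≠ 0) {a a' : ℤ} (ha : Squarefree a)
    (haa' : a ≡ a' [ZMOD (n : ℤ) * ∏ p ∈ n.primeFactors, (p : ℤ)])
    {s : Finset L} (hs : Lagrange.nodal s id = X ^ n - C (a : L))
    {c : Fin n → ℤ} {q : ℤ} (hq : q ≠ 0)
    (h : ∀ x ∈ s, v (∑ i, (c i : L) * x ^ (i : ℕ)) ≤ v (q : L)) {x' : L} (hx' : x' ^ n = a') :
    v (∑ i, (c i : L) * x' ^ (i : ℕ)) ≤ v (q : L) := by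
  classical
  set f : L[X] := ∑ i : Fin n, C (c i : L) * X ^ (i : ℕ) with hf
  have hdeg : f.degree < n := degree_sum_fin_lt _
  have heval (x : L) : f.eval x = ∑ i, (c i : L) * x ^ (i : ℕ) := by simp [hf, eval_finsetSum]
  simp only [← heval] at h ⊢
  rcases (v.map_intCast_le_one a).lt_or_eq with hva | hva
  · obtain ⟨x, hx⟩ : s.Nonempty :=
      Finset.card_ne_zero.mp (by rwa [Lagrange.card_eq_of_nodal_eq hs])
    have hvx' : v x' ≤ 1 := by
      refine (pow_le_one_iff hn).mp ?_
      rw [← map_pow, hx']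
      exact v.map_intCast_le_one a'
    rw [heval]
    refine v.map_sum_le fun i _ => ?_
    rw [map_mul, map_pow]
    refine (mul_le_of_le_one_right' (pow_le_one' hvx' _)).trans ?_
    have hx1 := h x hx
    rw [heval] at hx1
    exact v.map_intCast_le_of_eisenstein ha hva ((Lagrange.mem_iff_pow_eq_of_nodal_eq hs).mp hx)
      hq hx1 i
  have hvn1 : v (n : L) ≤ 1 := by simpa using v.map_intCast_le_one (L := L) n
  rcases hvn1.lt_or_eq with hvn | hvn
  · obtain ⟨p, hp, hpn, hvp⟩ := v.exists_prime_dvd_map_lt_one hn hvn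
    refine v.map_eval_le_of_forall_root hn hs hva hp hvp ?_ hx' hdeg h
    -- The period is a multiple of n * p, the precision that the interpolation bound requires.
    obtain ⟨t, ht⟩ := (mul_dvd_mul_left (n : ℤ) (Finset.dvd_prod_of_mem (fun p : ℕ => (p : ℤ))
      (Nat.mem_primeFactors.mpr ⟨hp, hpn, hn⟩))).trans haa'.dvd
    have : (a' : L) - a = n * p * (t : ℤ) := by exact_mod_cast congrArg (Int.cast : ℤ → L) ht
    rw [this, map_mul, map_mul]
    exact mul_le_of_le_one_right' (v.map_intCast_le_one t)
  · have hvx' : v x' ≤ 1 := by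
      refine (pow_le_one_iff hn).mp ?_
      rw [← map_pow, hx']
      exact v.map_intCast_le_one a'
    rw [heval]
    refine v.map_sum_le fun i _ => ?_
    rw [map_mul, map_pow]
    refine (mul_le_of_le_one_right' (pow_le_one' hvx' _)).trans ?_
    have := v.map_coeff_le_of_forall_root hn hs hva hvn hdeg h i
    simpa [hf, coeff_X_pow, Fin.val_inj] using this

end Valuation

theorem isIntegral_sum_of_forall_root {L : Type*} [Field L] [CharZero L] [IsAlgClosed L]
    {n : ℕ} (hn : n ≠ 0) {a a' : ℤ} (ha : Squarefree a)
    (haa' : a ≡ a' [ZMOD (n : ℤ) * ∏ p ∈ n.primeFactors, (p : ℤ)])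
    {c : Fin n → ℤ} {q : ℤ} (hq : q ≠ 0)
    (h : ∀ x : L, x ^ n = a → IsIntegral ℤ ((1 / (q : L)) * ∑ i, (c i : L) * x ^ (i : ℕ)))
    {x' : L} (hx' : x' ^ n = a') :
    IsIntegral ℤ ((1 / (q : L)) * ∑ i, (c i : L) * x' ^ (i : ℕ)) := by
  obtain ⟨s, hs⟩ := Lagrange.exists_nodal_eq_X_pow_sub_C (L := L) hn
    (Int.cast_ne_zero.mpr ha.ne_zero : (a : L) ≠ 0)
  refine isIntegral_of_forall_valuationSubring fun V => ?_
  have hq0 : 0 < V.valuation (q : L) := by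
    rw [zero_lt_iff, Valuation.ne_zero_iff]
    exact Int.cast_ne_zero.mpr hq
  have key (y : L) : V.valuation ((1 / (q : L)) * y) ≤ 1 ↔ V.valuation y ≤ V.valuation (q : L) := by
    rw [one_div_mul_eq_div, map_div₀, div_le_one₀ hq0]
  rw [key]
  refine V.valuation.map_sum_le_of_forall_root hn ha haa' hs hq (fun x hx => ?_) hx'
  rw [← key]
  exact (h x ((Lagrange.mem_iff_pow_eq_of_nodal_eq hs).mp hx)).valuation_le_one _

/-! ### Pure fields and their power bases -/

section PureField

variable {K : Type*} [Field K] [NumberField K] {n : ℕ} {θ : K} {a : ℤ}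

theorem natDegree_minpoly_of_adjoin_eq_top (hK : Module.finrank ℚ K = n)
    (hgen : IntermediateField.adjoin ℚ {θ} = ⊤) : (minpoly ℚ θ).natDegree = n := by
  rw [← IntermediateField.adjoin.finrank (Algebra.IsIntegral.isIntegral θ), hgen,
    IntermediateField.finrank_top', hK]

theorem minpoly_eq_X_pow_sub_C (hn : n ≠ 0) (hK : Module.finrank ℚ K = n) (hθ : θ ^ n = (a : K))
    (hgen : IntermediateField.adjoin ℚ {θ} = ⊤) : minpoly ℚ θ = X ^ n - C (a : ℚ) := by
  refine (eq_of_monic_of_dvd_of_natDegree_le (minpoly.monic (Algebra.IsIntegral.isIntegral θ))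
    (monic_X_pow_sub_C _ hn) (minpoly.dvd ℚ θ (by simp [hθ])) ?_).symm
  rw [natDegree_X_pow_sub_C, natDegree_minpoly_of_adjoin_eq_top hK hgen]

theorem exists_algHom_map_eq_root {L : Type*} [Field L] [Algebra ℚ L] [IsAlgClosed L] (hn : n ≠ 0)
    (hK : Module.finrank ℚ K = n) (hθ : θ ^ n = (a : K))
    (hgen : IntermediateField.adjoin ℚ {θ} = ⊤) {x : L} (hx : x ^ n = a) :
    ∃ φ : K →ₐ[ℚ] L, φ θ = x :=
  IntermediateField.exists_algHom_of_splits_of_aeval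
    (fun s => ⟨Algebra.IsIntegral.isIntegral s, IsAlgClosed.splits _⟩)
    (by simp [minpoly_eq_X_pow_sub_C hn hK hθ hgen, hx])

/-- The basis `1, θ, …, θ ^ (n - 1)` of a field of degree `n` generated by `θ`. -/
noncomputable def powBasis (hK : Module.finrank ℚ K = n)
    (hgen : IntermediateField.adjoin ℚ {θ} = ⊤) : Module.Basis (Fin n) ℚ K :=
  haveI : Nonempty (Fin n) := Fin.pos_iff_nonempty.mp (hK ▸ Module.finrank_pos)
  basisOfLinearIndependentOfCardEqFinrank (b := fun i : Fin n => θ ^ (i : ℕ))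
    (by
      have := linearIndependent_pow (K := ℚ) θ
      rwa [natDegree_minpoly_of_adjoin_eq_top hK hgen] at this)
    (by simp [hK])

@[simp]
theorem powBasis_apply (hK : Module.finrank ℚ K = n)
    (hgen : IntermediateField.adjoin ℚ {θ} = ⊤) (i : Fin n) :
    powBasis hK hgen i = θ ^ (i : ℕ) := by
  simp [powBasis]

end PureField

/-! ### Transfer of integrality between K and K' -/

section Transfer

variable {n : ℕ} {a a' : ℤ} {K K' : Type*} [Field K] [NumberField K] [Field K'] [NumberField K']
  {θ : K} {θ' : K'}

theorem isIntegral_sum_of_modEq_of_isAlgClosed (L : Type*) [Field L] [Algebra ℚ L] [IsAlgClosed L]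
    (hn : n ≠ 0) (ha : Squarefree a)
    (haa' : a ≡ a' [ZMOD (n : ℤ) * ∏ p ∈ n.primeFactors, (p : ℤ)])
    (hK : Module.finrank ℚ K = n) (hθ : θ ^ n = (a : K))
    (hgen : IntermediateField.adjoin ℚ {θ} = ⊤) (hθ' : θ' ^ n = (a' : K'))
    (c : Fin n → ℤ) {q : ℤ} (hq : q ≠ 0)
    (h : IsIntegral ℤ ((1 / (q : K)) * ∑ i : Fin n, (c i : K) * θ ^ (i : ℕ))) :
    IsIntegral ℤ ((1 / (q : K')) * ∑ i : Fin n, (c i : K') * θ' ^ (i : ℕ)) := by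
  have : CharZero L := algebraRat.charZero L
  let ψ : K' →ₐ[ℚ] L := IsAlgClosed.lift
  refine (isIntegral_algHom_iff (ψ.restrictScalars ℤ) ψ.injective).mp ?_
  have := isIntegral_sum_of_forall_root (L := L) hn ha haa' (c := c) hq (fun x hx => ?_)
    (x' := ψ θ') (by rw [← map_pow, hθ', map_intCast])
  · simpa using this
  -- Every root is a conjugate of θ, so integrality in K gives it at all roots.
  · obtain ⟨φ, rfl⟩ := exists_algHom_map_eq_root hn hK hθ hgen hx
    simpa using h.map (φ.restrictScalars ℤ)

theorem isIntegral_sum_of_modEq (hn : n ≠ 0) (ha : Squarefree a)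
    (haa' : a ≡ a' [ZMOD (n : ℤ) * ∏ p ∈ n.primeFactors, (p : ℤ)])
    (hK : Module.finrank ℚ K = n) (hθ : θ ^ n = (a : K))
    (hgen : IntermediateField.adjoin ℚ {θ} = ⊤) (hθ' : θ' ^ n = (a' : K'))
    (c : Fin n → ℤ) {q : ℤ} (hq : q ≠ 0)
    (h : IsIntegral ℤ ((1 / (q : K)) * ∑ i : Fin n, (c i : K) * θ ^ (i : ℕ))) :
    IsIntegral ℤ ((1 / (q : K')) * ∑ i : Fin n, (c i : K') * θ' ^ (i : ℕ)) :=
  isIntegral_sum_of_modEq_of_isAlgClosed (AlgebraicClosure ℚ) hn ha haa' hK hθ hgen hθ' c hq h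

theorem exists_int_smul_powBasis (hK : Module.finrank ℚ K = n)
    (hgen : IntermediateField.adjoin ℚ {θ} = ⊤) (x : K) :
    ∃ (c : Fin n → ℤ) (q : ℤ), q ≠ 0 ∧ ∀ i, (powBasis hK hgen).repr x i = (c i : ℚ) / q := by
  obtain ⟨b, hb⟩ := IsLocalization.exist_integer_multiples_of_finite (nonZeroDivisors ℤ)
    (fun i => (powBasis hK hgen).repr x i)
  choose c hc using hb
  have hb0 : (b : ℤ) ≠ 0 := nonZeroDivisors.ne_zero b.2
  refine ⟨c, b, hb0, fun i => ?_⟩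
  have := hc i
  rw [eq_div_iff (Int.cast_ne_zero.mpr hb0), mul_comm]
  simpa using this.symm

theorem isIntegral_equiv_of_modEq (hn : n ≠ 0) (ha : Squarefree a)
    (haa' : a ≡ a' [ZMOD (n : ℤ) * ∏ p ∈ n.primeFactors, (p : ℤ)])
    (hK : Module.finrank ℚ K = n) (hθ : θ ^ n = (a : K))
    (hgen : IntermediateField.adjoin ℚ {θ} = ⊤)
    (hK' : Module.finrank ℚ K' = n) (hθ' : θ' ^ n = (a' : K'))
    (hgen' : IntermediateField.adjoin ℚ {θ'} = ⊤) {x : K} (hx : IsIntegral ℤ x) :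
    IsIntegral ℤ ((powBasis hK hgen).equiv (powBasis hK' hgen') (Equiv.refl _) x) := by
  obtain ⟨c, q, hq, hc⟩ := exists_int_smul_powBasis hK hgen x
  have hsum : x = (1 / (q : K)) * ∑ i : Fin n, (c i : K) * θ ^ (i : ℕ) := by
    conv_lhs => rw [← (powBasis hK hgen).sum_repr x]
    rw [Finset.mul_sum]
    refine Finset.sum_congr rfl fun i _ => ?_
    rw [hc, powBasis_apply, Algebra.smul_def, map_div₀, map_intCast, map_intCast]
    ring
  have hsum' : (powBasis hK hgen).equiv (powBasis hK' hgen') (Equiv.refl _) x =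
      (1 / (q : K')) * ∑ i : Fin n, (c i : K') * θ' ^ (i : ℕ) := by
    conv_lhs => rw [← (powBasis hK hgen).sum_repr x]
    rw [map_sum, Finset.mul_sum]
    refine Finset.sum_congr rfl fun i _ => ?_
    rw [map_smul, Module.Basis.equiv_apply, Equiv.refl_apply, hc, powBasis_apply, Algebra.smul_def,
      map_div₀, map_intCast, map_intCast]
    ring
  rw [hsum']
  exact isIntegral_sum_of_modEq hn ha haa' hK hθ hgen hθ' c hq (hsum ▸ hx)

/-- The ℚ-linear map θⁱ ↦ θ'ⁱ preserves integrality after clearing denominators; its inverse does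
too, the congruence being symmetric. It therefore carries integral bases to integral bases. -/
theorem exists_linearEquiv_of_modEq (hn : n ≠ 0) (ha : Squarefree a) (ha' : Squarefree a')
    (haa' : a ≡ a' [ZMOD (n : ℤ) * ∏ p ∈ n.primeFactors, (p : ℤ)])
    (hK : Module.finrank ℚ K = n) (hθ : θ ^ n = (a : K))
    (hgen : IntermediateField.adjoin ℚ {θ} = ⊤)
    (hK' : Module.finrank ℚ K' = n) (hθ' : θ' ^ n = (a' : K'))
    (hgen' : IntermediateField.adjoin ℚ {θ'} = ⊤) :
    ∃ e : K ≃ₗ[ℤ] K', (∀ x, IsIntegral ℤ (e x) ↔ IsIntegral ℤ x) ∧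
      ∀ b : Fin n → ℚ, e (∑ i, (b i : K) * θ ^ (i : ℕ)) = ∑ i, (b i : K') * θ' ^ (i : ℕ) := by
  let E : K ≃ₗ[ℚ] K' := (powBasis hK hgen).equiv (powBasis hK' hgen') (Equiv.refl _)
  refine ⟨E.toAddEquiv.toIntLinearEquiv, fun x => ?_, fun b => ?_⟩
  · change IsIntegral ℤ (E x) ↔ IsIntegral ℤ x
    refine ⟨fun hx => ?_, isIntegral_equiv_of_modEq hn ha haa' hK hθ hgen hK' hθ' hgen'⟩
    have := isIntegral_equiv_of_modEq hn ha' haa'.symm hK' hθ' hgen' hK hθ hgen hx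
    have hsymm : (powBasis hK' hgen').equiv (powBasis hK hgen) (Equiv.refl _) = E.symm :=
      (powBasis hK' hgen').ext' fun i => by
        rw [LinearEquiv.eq_symm_apply, Module.Basis.equiv_apply, Equiv.refl_apply,
          Module.Basis.equiv_apply, Equiv.refl_apply]
    rwa [hsymm, LinearEquiv.symm_apply_apply] at this
  · change E _ = _
    rw [map_sum]
    refine Finset.sum_congr rfl fun i _ => ?_
    have h1 : (b i : K) * θ ^ (i : ℕ) = b i • powBasis hK hgen i := by
      rw [powBasis_apply, Algebra.smul_def, eq_ratCast]
    rw [h1, map_smul, Module.Basis.equiv_apply, Equiv.refl_apply, powBasis_apply, Algebra.smul_def,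
      eq_ratCast]

end Transfer

theorem IsIntegralBasis.map {K K' : Type*} [Field K] [Field K'] {n : ℕ} {ω : Fin n → K}
    (h : IsIntegralBasis K ω) (e : K ≃ₗ[ℤ] K') (he : ∀ x, IsIntegral ℤ (e x) ↔ IsIntegral ℤ x) :
    IsIntegralBasis K' (e ∘ ω) := by
  refine ⟨h.1.map' e.toLinearMap e.ker, ?_⟩
  rw [Set.range_comp, ← LinearEquiv.coe_coe, ← Submodule.map_span, Submodule.map_coe, h.2]
  ext y
  constructor
  · rintro ⟨x, hx, rfl⟩
    exact (he x).mpr hx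
  · intro hy
    exact ⟨e.symm y, (he _).mp (by simpa using hy), by simp⟩

theorem theorem3 (n : ℕ) (hn : 2 ≤ n) (a a' : ℤ) (ha : Squarefree a) (ha' : Squarefree a')
    (haa' : a ≡ a' [ZMOD (n : ℤ) * ∏ p ∈ n.primeFactors, (p : ℤ)])
    (K : Type*) [Field K] [NumberField K] (hK : Module.finrank ℚ K = n)
    (K' : Type*) [Field K'] [NumberField K'] (hK' : Module.finrank ℚ K' = n)
    (θ : K) (hθ : θ ^ n = (a : K)) (hgen : IntermediateField.adjoin ℚ {θ} = ⊤)
    (θ' : K') (hθ' : θ' ^ n = (a' : K')) (hgen' : IntermediateField.adjoin ℚ {θ'} = ⊤) :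
    (∀ (c : Fin n → ℤ) (q : ℤ), q ≠ 0 →
      (IsIntegral ℤ ((1 / (q : K)) * ∑ i : Fin n, (c i : K) * θ ^ (i : ℕ)) ↔
        IsIntegral ℤ ((1 / (q : K')) * ∑ i : Fin n, (c i : K') * θ' ^ (i : ℕ)))) ∧
    (∀ b : Fin n → Fin n → ℚ,
      (IsIntegralBasis K (fun m => ∑ i : Fin n, (b m i : K) * θ ^ (i : ℕ)) ↔
        IsIntegralBasis K' (fun m => ∑ i : Fin n, (b m i : K') * θ' ^ (i : ℕ)))) := by
  have hn0 : n ≠ 0 := by omega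
  refine ⟨fun c q hq => ⟨isIntegral_sum_of_modEq hn0 ha haa' hK hθ hgen hθ' c hq,
    isIntegral_sum_of_modEq hn0 ha' haa'.symm hK' hθ' hgen' hθ c hq⟩, fun b => ?_⟩
  obtain ⟨e, he, hsum⟩ :=
    exists_linearEquiv_of_modEq hn0 ha ha' haa' hK hθ hgen hK' hθ' hgen'
  have he' (y : K') : IsIntegral ℤ (e.symm y) ↔ IsIntegral ℤ y := by
    rw [← he, LinearEquiv.apply_symm_apply]
  refine ⟨fun h => ?_, fun h => ?_⟩
  · simpa only [Function.comp_def, hsum] using h.map e he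
  · simpa only [Function.comp_def, ← hsum, LinearEquiv.symm_apply_apply] using h.map e.symm he'
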